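/- Let $G$ be a countable discrete ICC group, i.e. an infinite countable group all of whose non-trivial conjugacy classes are infinite, and let $A = C^*_r(G)$ be its reduced group $C^*$-algebra, i.e. the norm-closed $*$-subalgebra of $B(\ell^2(G))$ generated by the image of the left regular representation. Let $U_A$ be the connected component of the unit in the unitary group of $A$ (with the norm topology), let $CU_A$ be the closure of the commutator subgroup of $U_A$, and write $\mathcal{Z}(H)$ for the center of a group $H$. Then the following are equivalent: 1. all proper quotients of $A$ are abelian, i.e. $A/I$ is commutative for every non-zero closed two-sided ideal $I$ of $A$; 2. $CU_A/\mathcal{Z}(CU_A)$, with the quotient topology, is topologically simple, i.e. its only closed normal subgroups are the trivial subgroup and the whole group. Moreover, in that case $\mathcal{Z}(CU_A) \subseteq \mathcal{Z}(U_A) = \mathbb{T}$, where $\mathbb{T}$ is identified with the group $\{z 1 \mid z\in\mathbb{C},\ |z|=1\}$ of scalar unitaries of $A$. -/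

import Mathlib

open scoped lp ENNReal

/-- An infinite conjugacy class (ICC) group: an infinite group in which every non-trivial
conjugacy class is infinite. -/
def IsICC (G : Type*) [Group G] : Prop :=
  Infinite G ∧ ∀ g : G, g ≠ 1 → (conjugatesOf g).Infinite

section RegularRepresentation

variable {G : Type*} [Group G]

/-- Left translation by `s` on `ℓ²(G)`, as a linear isometry: `(s · f) t = f (s⁻¹ * t)`. -/
noncomputable def leftTranslate (s : G) :
    lp (fun _ : G => ℂ) 2 →ₗᵢ[ℂ] lp (fun _ : G => ℂ) 2 where
  toFun f := ⟨fun t => f (s⁻¹ * t), by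
    have hp : 0 < (2 : ℝ≥0∞).toReal := by simp
    exact memℓp_gen (((Equiv.mulLeft s⁻¹).summable_iff
      (f := fun t => ‖f t‖ ^ (2 : ℝ≥0∞).toReal)).2 ((lp.memℓp f).summable hp))⟩
  map_add' f g := by ext t; rfl
  map_smul' c f := by ext t; rfl
  norm_map' f := by
    have hp : 0 < (2 : ℝ≥0∞).toReal := by simp
    rw [lp.norm_eq_tsum_rpow hp, lp.norm_eq_tsum_rpow hp]
    congr 1
    exact (Equiv.mulLeft s⁻¹).tsum_eq (fun t => ‖f t‖ ^ (2 : ℝ≥0∞).toReal)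

theorem leftTranslate_apply (s : G) (f : lp (fun _ : G => ℂ) 2) (t : G) :
    leftTranslate s f t = f (s⁻¹ * t) := rfl

variable (G) in
/-- The left regular representation `λ : G → B(ℓ²(G))`, `(λ(s) f) t = f (s⁻¹ * t)`. -/
noncomputable def leftRegular :
    G →* (lp (fun _ : G => ℂ) 2 →L[ℂ] lp (fun _ : G => ℂ) 2) where
  toFun s := (leftTranslate s).toContinuousLinearMap
  map_one' := by
    ext f t
    change f (1⁻¹ * t) = f t
    simp
  map_mul' s r := by
    ext f t
    change f ((s * r)⁻¹ * t) = f (r⁻¹ * (s⁻¹ * t))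
    rw [mul_inv_rev, mul_assoc]

variable (G) in
/-- The reduced group C⋆-algebra `C*_r(G)` of the discrete group `G`: the norm-closed unital
⋆-subalgebra of `B(ℓ²(G))` generated by the image of the left regular representation. -/
noncomputable def reducedGroupCStarAlgebra :
    StarSubalgebra ℂ (lp (fun _ : G => ℂ) 2 →L[ℂ] lp (fun _ : G => ℂ) 2) :=
  (StarAlgebra.adjoin ℂ (Set.range (leftRegular G))).topologicalClosure

variable (G) in
theorem isClosed_reducedGroupCStarAlgebra :
    IsClosed (reducedGroupCStarAlgebra G :
      Set (lp (fun _ : G => ℂ) 2 →L[ℂ] lp (fun _ : G => ℂ) 2)) :=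
  StarSubalgebra.isClosed_topologicalClosure _

noncomputable instance instCStarAlgebraReducedGroup :
    CStarAlgebra (reducedGroupCStarAlgebra G) :=
  haveI := isClosed_reducedGroupCStarAlgebra G
  StarSubalgebra.cstarAlgebra (reducedGroupCStarAlgebra G)

end RegularRepresentation

section UnitaryGroups

variable (A : Type*) [CStarAlgebra A]

/-- `U_A`: the connected component of the unit in the unitary group `U(A)` of the unital
C⋆-algebra `A`, with the norm topology. -/
noncomputable def unitaryComponent : Subgroup (unitary A) :=
  Subgroup.connectedComponentOfOne (unitary A)

/-- `CU_A`: the closure of the commutator subgroup `(U_A, U_A)`, as a subgroup of `U(A)`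
(the closure in `U(A)` is contained in `U_A`, since `U_A` is closed). -/
noncomputable def closedCommutatorUnitary : Subgroup (unitary A) :=
  ⁅unitaryComponent A, unitaryComponent A⁆.topologicalClosure

/-- The center of the subgroup `H`, viewed as a subgroup of the ambient group. -/
def centerOf {Γ : Type*} [Group Γ] (H : Subgroup Γ) : Subgroup Γ :=
  (Subgroup.center H).map H.subtype

/-- The circle group `𝕋`, viewed as the group of scalar unitaries `z • 1`, `|z| = 1`. -/
noncomputable def scalarUnitaries : Subgroup (unitary A) where
  carrier := {u | ∃ z : Circle, (u : A) = algebraMap ℂ A z}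
  one_mem' := ⟨1, by simp⟩
  mul_mem' := by
    rintro u v ⟨z, hz⟩ ⟨w, hw⟩
    exact ⟨z * w, by simp [hz, hw]⟩
  inv_mem' := by
    rintro u ⟨z, hz⟩
    refine ⟨z⁻¹, ?_⟩
    rw [← Unitary.star_eq_inv, Unitary.coe_star, hz, ← algebraMap_star_comm,
      Circle.coe_inv_eq_conj]
    rfl

/-- Every proper quotient of `A`, that is every quotient by a non-zero closed two-sided ideal,
is abelian. (The zero quotient `A ⧸ A` is trivially abelian.) -/
def AllProperQuotientsAbelian : Prop :=
  ∀ (I : Ideal A) [I.IsTwoSided], IsClosed (I : Set A) → I ≠ ⊥ →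
    ∀ x y : A ⧸ I, x * y = y * x

end UnitaryGroups

/-- A topological group is topologically simple if its only closed normal subgroups are the
trivial subgroup and the whole group. -/
def IsTopologicallySimple (Γ : Type*) [Group Γ] [TopologicalSpace Γ] : Prop :=
  ∀ N : Subgroup Γ, N.Normal → IsClosed (N : Set Γ) → N = ⊥ ∨ N = ⊤

/-!
The equivalence holds for every unital C⋆-algebra `A` with trivial center; the group enters only
through `exists_eq_algebraMap_of_central`, which says that `C*_r(G)` has trivial center when `G` is
ICC (operators in `C*_r(G)` commute with right translations, so a central one maps `δ₁` to a square
summable function that is constant on conjugacy classes).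

The tool is the complexified Lie algebra `unitaryLie H` of a closed subgroup `H` of the unitary
group. Trotter's formula makes it a closed complex ⋆-subspace of `A`. The Lie algebra of `CU_A`
contains all commutators, and if `CU_A` normalizes `H`, the Lie algebra `V` of `H` is invariant
under bracketing with commutators and contains `u d u⋆ - d` for `u ∈ H` and every commutator `d`.

If all proper quotients are abelian and `N ≤ CU_A` is closed, normal and not central, then `V` is
not central, and a Herstein type argument applies. The set `T = {x | [x, A] ⊆ V}` is a closed
⋆-subalgebra invariant under bracketing with commutators, it contains `[V, V]`, and it is
noncommutative because `[x, [x, b]] = 0` forces `[x, b] = 0` for selfadjoint `x`. Such a subalgebra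
contains a nonzero ideal `I` (`pow_mem_largestIdeal`). By hypothesis `I` contains all commutators;
since `[I, A] ⊆ V` and conjugation by unitaries is isometric, `V` contains all `u b u⋆ - b`
(`unitary_conj_sub_mem`). A second use of Trotter's formula shows that `N` contains the commutators
of `U_A` (`closedCommutatorUnitary_le_of_conj_sub_mem`).

Conversely, let `I` be a nonzero proper closed ideal. The elements of `CU_A` that are central
modulo `I` form a closed normal subgroup containing the center of `CU_A`. It is not the center
(`eq_bot_of_centralModulo_le_center`), so by simplicity it is `CU_A`. Differentiating twice,
commutators commute modulo `I`, and as closed ideals are semiprime, `A ⧸ I` is commutative.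
-/

/-! ### One-parameter groups of unitaries -/

section OneParameter

open Filter Topology NormedSpace selfAdjoint
open scoped ComplexStarModule

variable {A : Type*} [CStarAlgebra A]

theorem hasDerivAt_expUnitary (x : selfAdjoint A) (t : ℝ) :
    HasDerivAt (fun s : ℝ => (expUnitary (s • x) : A))
      ((expUnitary (t • x) : A) * (Complex.I • (x : A))) t := by
  have h := hasDerivAt_exp_smul_const (𝕂 := ℝ) (Complex.I • (x : A)) t
  simpa [expUnitary_coe, smul_comm Complex.I] using h

theorem hasDerivAt_conj_expUnitary (x : selfAdjoint A) (b : A) (t : ℝ) :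
    HasDerivAt (fun s : ℝ => (expUnitary (s • x) : A) * b * (expUnitary (-(s • x)) : A))
      (Complex.I • ((expUnitary (t • x) : A) * (x * b - b * x) * (expUnitary (-(t • x)) : A)))
      t := by
  have h1 := (hasDerivAt_expUnitary x t).mul_const b
  have h2 : HasDerivAt (fun s : ℝ => (expUnitary (-(s • x)) : A))
      ((-(Complex.I • (x : A))) * (expUnitary (-(t • x)) : A)) t := by
    have h := hasDerivAt_exp_smul_const' (𝕂 := ℝ) (-(Complex.I • (x : A))) t
    simpa [expUnitary_coe, smul_comm Complex.I] using h
  refine (h1.mul h2).congr_deriv ?_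
  simp only [smul_mul_assoc, mul_smul_comm, mul_sub, sub_mul, neg_mul, mul_neg, smul_sub, mul_assoc]
  abel

theorem expUnitary_neg (x : selfAdjoint A) : expUnitary (-x) = (expUnitary x)⁻¹ := by
  rw [eq_inv_iff_mul_eq_one]
  have h : Commute ((-x : selfAdjoint A) : A) (x : A) := by simp
  rw [← h.expUnitary_add]; simp

theorem expUnitary_nsmul (n : ℕ) (x : selfAdjoint A) :
    expUnitary (n • x) = expUnitary x ^ n := by
  induction n with
  | zero => simp
  | succ k ih =>
    have h : Commute ((k • x : selfAdjoint A) : A) (x : A) := by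
      simp
    rw [succ_nsmul, h.expUnitary_add, ih, pow_succ]

theorem norm_unitary_pow_sub_pow_le (S T : unitary A) (n : ℕ) :
    ‖((S ^ n : unitary A) : A) - (T ^ n : unitary A)‖ ≤ n * ‖(S : A) - T‖ := by
  induction n with
  | zero => simp
  | succ k ih =>
    have h : ((S ^ (k + 1) : unitary A) : A) - (T ^ (k + 1) : unitary A)
        = ((S ^ k : unitary A) : A) * ((S : A) - T)
          + (((S ^ k : unitary A) : A) - (T ^ k : unitary A)) * T := by
      simp only [pow_succ, Submonoid.coe_mul]; noncomm_ring
    rw [h]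
    refine (norm_add_le _ _).trans ?_
    rw [CStarRing.norm_coe_unitary_mul, CStarRing.norm_mul_coe_unitary]
    push_cast at ih ⊢; linarith

/-- The Lie–Trotter product formula, for one-parameter groups of unitaries. -/
theorem tendsto_trotter (x y : selfAdjoint A) :
    Tendsto (fun n : ℕ => (expUnitary ((n : ℝ)⁻¹ • x) * expUnitary ((n : ℝ)⁻¹ • y)) ^ n) atTop
      (𝓝 (expUnitary (x + y))) := by
  -- the difference of the two curves below has vanishing derivative at `0`
  have hd : HasDerivAt (fun s : ℝ => ((expUnitary (s • x) : A) * (expUnitary (s • y) : A))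
      - (expUnitary (s • (x + y)) : A)) 0 0 := by
    have h := ((hasDerivAt_expUnitary x 0).mul (hasDerivAt_expUnitary y 0)).sub
      (hasDerivAt_expUnitary (x + y) 0)
    refine h.congr_deriv ?_
    simp
  have hs := hd.tendsto_slope_zero
  have hn : Tendsto (fun n : ℕ => ((n : ℝ)⁻¹)) atTop (𝓝[≠] 0) := by
    refine tendsto_nhdsWithin_iff.2 ⟨tendsto_inv_atTop_nhds_zero_nat, ?_⟩
    filter_upwards [eventually_gt_atTop 0] with n hn
    simp; omega
  have ht := (hs.comp hn).norm
  rw [tendsto_subtype_rng, tendsto_iff_norm_sub_tendsto_zero]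
  refine squeeze_zero' (.of_forall fun _ => norm_nonneg _) ?_ (by simpa using ht)
  filter_upwards [eventually_gt_atTop 0] with n hn
  have hn' : (n : ℝ) ≠ 0 := by positivity
  have e : expUnitary (x + y) = expUnitary ((n : ℝ)⁻¹ • (x + y)) ^ n := by
    rw [← expUnitary_nsmul, ← Nat.cast_smul_eq_nsmul ℝ, smul_smul, mul_inv_cancel₀ hn', one_smul]
  rw [e]
  refine (norm_unitary_pow_sub_pow_le _ _ n).trans (le_of_eq ?_)
  simp [norm_smul]

/-- If `[x, b]` commutes with the selfadjoint `x`, it vanishes: the curve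
`exp(itx) b exp(-itx)` is both affine in `t` and bounded. -/
theorem commute_of_commute_commutator {x b : A} (hx : IsSelfAdjoint x)
    (h : x * (x * b - b * x) = (x * b - b * x) * x) : x * b = b * x := by
  lift x to selfAdjoint A using hx
  set y := (x : A) * b - b * x with hy
  have hc : ∀ t : ℝ, (expUnitary (t • x) : A) * y * (expUnitary (-(t • x)) : A) = y := by
    intro t
    have h0 : ∀ s : ℝ, HasDerivAt
        (fun s : ℝ => (expUnitary (s • x) : A) * y * (expUnitary (-(s • x)) : A)) 0 s := by
      intro s
      simpa [h] using hasDerivAt_conj_expUnitary x y s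
    have := is_const_of_deriv_eq_zero (fun s => (h0 s).differentiableAt) (fun s => (h0 s).deriv) t 0
    simpa using this
  have hl : ∀ t : ℝ, (expUnitary (t • x) : A) * b * (expUnitary (-(t • x)) : A)
      = b + t • (Complex.I • y) := by
    intro t
    have h0 : ∀ s : ℝ, HasDerivAt
        (fun s : ℝ => (expUnitary (s • x) : A) * b * (expUnitary (-(s • x)) : A)
          - s • (Complex.I • y)) 0 s := by
      intro s
      have := (hasDerivAt_conj_expUnitary x b s).sub ((hasDerivAt_id s).smul_const (Complex.I • y))
      rw [← hy, hc] at this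
      exact this.congr_deriv (by simp)
    have := is_const_of_deriv_eq_zero (fun s => (h0 s).differentiableAt) (fun s => (h0 s).deriv) t 0
    rw [← sub_eq_iff_eq_add]
    simpa using this
  have hb : ∀ n : ℕ, n * ‖y‖ ≤ 2 * ‖b‖ := by
    intro n
    have h1 : ‖(n : ℝ) • (Complex.I • y)‖ = n * ‖y‖ := by simp [norm_smul]
    rw [← h1, eq_sub_of_add_eq' (hl n).symm]
    refine (norm_sub_le _ _).trans ?_
    rw [CStarRing.norm_mul_coe_unitary, CStarRing.norm_coe_unitary_mul]; linarith
  have : y = 0 := by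
    by_contra hne
    have hpos : 0 < ‖y‖ := norm_pos_iff.2 hne
    obtain ⟨n, hn⟩ := exists_nat_gt (2 * ‖b‖ / ‖y‖)
    rw [div_lt_iff₀ hpos] at hn
    linarith [hb n]
  exact sub_eq_zero.1 this

end OneParameter

/-! ### The Lie algebra of a closed subgroup of the unitary group -/

section LieAlgebra

open Filter Topology NormedSpace selfAdjoint
open scoped ComplexStarModule

variable {A : Type*} [CStarAlgebra A]

theorem continuous_realPart : Continuous (realPart : A → selfAdjoint A) := by
  rw [continuous_induced_rng]
  have : (Subtype.val ∘ (realPart : A → selfAdjoint A)) = fun a => (2 : ℝ)⁻¹ • (a + star a) := by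
    ext a; exact realPart_apply_coe a
  rw [this]
  fun_prop

theorem realPart_real_smul_smul (r : ℝ) (z : ℂ) (x : A) :
    ℜ (((r : ℂ) * z) • x) = r • ℜ (z • x) := by
  rw [mul_smul, Complex.coe_smul, map_smul]

theorem expUnitary_conj (u : unitary A) {x y : selfAdjoint A}
    (h : (y : A) = u * x * star (u : A)) : expUnitary y = u * expUnitary x * u⁻¹ := by
  ext
  let +nondep : NormedAlgebra ℚ A := .restrictScalars ℚ ℂ A
  have e := exp_units_conj (Unitary.toUnits u) (Complex.I • (x : A))
  have e1 : ((Unitary.toUnits u : Aˣ) : A) = u := rfl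
  have e2 : (((Unitary.toUnits u)⁻¹ : Aˣ) : A) = star (u : A) := rfl
  rw [e1, e2] at e
  rw [expUnitary_coe, h]
  simpa [mul_smul_comm, smul_mul_assoc, ← Unitary.star_eq_inv] using e

theorem coe_realPart_smul_conj (u : unitary A) (z : ℂ) (x : A) :
    (ℜ (z • ((u : A) * x * star (u : A))) : A) = u * (ℜ (z • x) : A) * star (u : A) := by
  simp only [realPart_apply_coe, star_smul, star_mul, star_star, mul_add, add_mul, smul_add,
    mul_smul_comm, smul_mul_assoc, mul_assoc]

/-- The complexified Lie algebra of a closed subgroup `H` of the unitary group: the complex span of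
the selfadjoint `x` whose one-parameter group `t ↦ exp(itx)` lies in `H`. It is encoded by
requiring that the selfadjoint part of every complex multiple of `x` exponentiates into `H`. -/
noncomputable def unitaryLie (H : Subgroup (unitary A)) (hH : IsClosed (H : Set (unitary A))) :
    Submodule ℂ A where
  carrier := {x | ∀ z : ℂ, expUnitary (ℜ (z • x)) ∈ H}
  zero_mem' z := by simp [H.one_mem]
  smul_mem' c x hx z := by rw [smul_smul]; exact hx _
  add_mem' {x y} hx hy z := by
    rw [smul_add, map_add]
    refine hH.mem_of_tendsto (tendsto_trotter _ _) (.of_forall fun n => H.pow_mem ?_ n)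
    rw [← realPart_real_smul_smul, ← realPart_real_smul_smul]
    exact H.mul_mem (hx _) (hy _)

variable {H K : Subgroup (unitary A)} {hH : IsClosed (H : Set (unitary A))}
  {hK : IsClosed (K : Set (unitary A))}

theorem mem_unitaryLie {x : A} :
    x ∈ unitaryLie H hH ↔ ∀ z : ℂ, expUnitary (ℜ (z • x)) ∈ H := Iff.rfl

theorem isClosed_unitaryLie : IsClosed (unitaryLie H hH : Set A) := by
  have : (unitaryLie H hH : Set A) =
      ⋂ z : ℂ, (fun x : A => expUnitary (ℜ (z • x))) ⁻¹' (H : Set (unitary A)) := by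
    ext x; simp [mem_unitaryLie]
  rw [this]
  exact isClosed_iInter fun z => hH.preimage
    (continuous_expUnitary.comp (continuous_realPart.comp (continuous_const_smul z)))

theorem star_mem_unitaryLie {x : A} (hx : x ∈ unitaryLie H hH) : star x ∈ unitaryLie H hH := by
  intro z
  have : ℜ (z • star x) = ℜ (star z • x) := by
    ext; simp [realPart_apply_coe, add_comm]
  rw [this]
  exact hx _

theorem expUnitary_mem_of_mem_unitaryLie {x : selfAdjoint A} (hx : (x : A) ∈ unitaryLie H hH) :
    expUnitary x ∈ H := by
  simpa using hx 1

theorem realPart_mem_of_star_mem {V : Submodule ℂ A} (hV : ∀ x ∈ V, star x ∈ V) {x : A}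
    (hx : x ∈ V) : (ℜ x : A) ∈ V := by
  rw [realPart_apply_coe, ← Complex.coe_smul]
  exact V.smul_mem _ (V.add_mem hx (hV _ hx))

theorem imaginaryPart_mem_of_star_mem {V : Submodule ℂ A} (hV : ∀ x ∈ V, star x ∈ V) {x : A}
    (hx : x ∈ V) : (ℑ x : A) ∈ V := by
  rw [imaginaryPart_apply_coe, ← Complex.coe_smul]
  exact V.smul_mem _ (V.smul_mem _ (V.sub_mem hx (hV _ hx)))

theorem conj_mem_unitaryLie {w : unitary A} (hw : ∀ h ∈ H, w * h * w⁻¹ ∈ H) {x : A}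
    (hx : x ∈ unitaryLie H hH) : (w : A) * x * star (w : A) ∈ unitaryLie H hH := by
  intro z
  rw [expUnitary_conj w (coe_realPart_smul_conj w z x)]
  exact hw _ (hx z)

/-- If the one-parameter groups of `x` lie in `K`, which normalizes `H`, then `h x h⋆ - x` belongs
to the Lie algebra of `H` for every `h ∈ H`. -/
theorem conj_sub_mem_unitaryLie (hn : ∀ k ∈ K, ∀ h ∈ H, k * h * k⁻¹ ∈ H) {x : A}
    (hx : x ∈ unitaryLie K hK) {h : unitary A} (hh : h ∈ H) :
    (h : A) * x * star (h : A) - x ∈ unitaryLie H hH := by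
  intro z
  rw [smul_sub, map_sub, sub_eq_add_neg]
  refine hH.mem_of_tendsto (tendsto_trotter _ _) (.of_forall fun n => H.pow_mem ?_ n)
  rw [smul_neg, ← realPart_real_smul_smul, ← realPart_real_smul_smul, expUnitary_neg,
    expUnitary_conj h (coe_realPart_smul_conj h _ x), mul_assoc h, mul_assoc h]
  refine H.mul_mem hh ?_
  exact hn _ (hx _) _ (H.inv_mem hh)

/-- Differentiating `t ↦ exp(itx) b exp(-itx) - b` at `0`. -/
theorem commutator_mem_of_conj_sub_mem {W : Submodule ℂ A} (hW : IsClosed (W : Set A))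
    {x : selfAdjoint A} {b : A}
    (h : ∀ t : ℝ, (expUnitary (t • x) : A) * b * star (expUnitary (t • x) : A) - b ∈ W) :
    (x : A) * b - b * x ∈ W := by
  have hd := (hasDerivAt_conj_expUnitary x b 0).tendsto_slope_zero
  have hm : Complex.I • ((x : A) * b - b * x) ∈ W := by
    have : Complex.I • ((expUnitary ((0 : ℝ) • x) : A) * (x * b - b * x) *
        (expUnitary (-((0 : ℝ) • x)) : A)) ∈ (W : Set A) := by
      refine hW.mem_of_tendsto hd (.of_forall fun t => ?_)
      have ht := h t
      rw [← Unitary.coe_star, Unitary.star_eq_inv, ← expUnitary_neg] at ht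
      have := W.smul_mem ((t⁻¹ : ℝ) : ℂ) ht
      rw [Complex.coe_smul] at this
      simpa using this
    simpa using this
  have := W.smul_mem (-Complex.I) hm
  simpa [smul_smul] using this

theorem commutator_mem_of_realPart_imaginaryPart {W : Submodule ℂ A} {x b : A}
    (h1 : (ℜ x : A) * b - b * ℜ x ∈ W) (h2 : (ℑ x : A) * b - b * ℑ x ∈ W) :
    x * b - b * x ∈ W := by
  have e : x * b - b * x = ((ℜ x : A) * b - b * ℜ x) +
      Complex.I • ((ℑ x : A) * b - b * ℑ x) := by
    conv_lhs => rw [← realPart_add_I_smul_imaginaryPart x]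
    simp only [add_mul, mul_add, smul_sub, smul_mul_assoc, mul_smul_comm]; abel
  rw [e]
  exact W.add_mem h1 (W.smul_mem _ h2)

/-- If conjugation by the elements of `K` fixes `b` modulo a closed subspace `W`, then `W` contains
the brackets of `b` with the Lie algebra of `K`. -/
theorem commutator_mem_of_forall_conj_sub_mem {W : Submodule ℂ A} (hW : IsClosed (W : Set A))
    {b : A} (h : ∀ k ∈ K, (k : A) * b * star (k : A) - b ∈ W) {d : A}
    (hd : d ∈ unitaryLie K hK) : d * b - b * d ∈ W := by
  have key : ∀ y : selfAdjoint A, (y : A) ∈ unitaryLie K hK → (y : A) * b - b * y ∈ W := by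
    refine fun y hy => commutator_mem_of_conj_sub_mem hW fun t => h _ ?_
    have := hy (t : ℂ)
    rwa [Complex.coe_smul, map_smul, realPart_coe] at this
  exact commutator_mem_of_realPart_imaginaryPart
    (key _ (realPart_mem_of_star_mem (fun _ => star_mem_unitaryLie) hd))
    (key _ (imaginaryPart_mem_of_star_mem (fun _ => star_mem_unitaryLie) hd))

/-- If `K` normalizes `H`, the Lie algebra of `H` is invariant under that of `K`. -/
theorem commutator_mem_unitaryLie (hn : ∀ k ∈ K, ∀ h ∈ H, k * h * k⁻¹ ∈ H) {d x : A}
    (hd : d ∈ unitaryLie K hK) (hx : x ∈ unitaryLie H hH) :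
    d * x - x * d ∈ unitaryLie H hH :=
  commutator_mem_of_forall_conj_sub_mem isClosed_unitaryLie
    (fun _ hk => Submodule.sub_mem _ (conj_mem_unitaryLie (hn _ hk) hx) hx) hd

end LieAlgebra

/-! ### The groups `U_A` and `CU_A` -/

section Component

open Filter Topology NormedSpace selfAdjoint
open scoped ComplexStarModule

variable {A : Type*} [CStarAlgebra A]

theorem mem_unitaryComponent {u : unitary A} :
    u ∈ unitaryComponent A ↔ ∃ l : List (selfAdjoint A), (l.map expUnitary).prod = u := by
  rw [← Unitary.mem_pathComponentOne_iff, pathComponent_eq_connectedComponent]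
  exact Iff.rfl

theorem expUnitary_mem_unitaryComponent (x : selfAdjoint A) :
    expUnitary x ∈ unitaryComponent A :=
  mem_unitaryComponent.2 ⟨[x], by simp⟩

theorem unitaryComponent_le {H : Subgroup (unitary A)} (h : ∀ x : selfAdjoint A, expUnitary x ∈ H) :
    unitaryComponent A ≤ H := by
  intro u hu
  obtain ⟨l, rfl⟩ := mem_unitaryComponent.1 hu
  refine H.list_prod_mem fun v hv => ?_
  obtain ⟨x, -, rfl⟩ := List.mem_map.1 hv
  exact h x

theorem isClosed_unitaryComponent : IsClosed (unitaryComponent A : Set (unitary A)) :=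
  isClosed_connectedComponent

theorem isClosed_closedCommutatorUnitary :
    IsClosed (closedCommutatorUnitary A : Set (unitary A)) :=
  Subgroup.isClosed_topologicalClosure _

theorem commutatorElement_mem_closedCommutatorUnitary {u v : unitary A}
    (hu : u ∈ unitaryComponent A) (hv : v ∈ unitaryComponent A) :
    u * v * u⁻¹ * v⁻¹ ∈ closedCommutatorUnitary A :=
  Subgroup.le_topologicalClosure _ (Subgroup.commutator_mem_commutator hu hv)

variable (A) in
/-- The complexified Lie algebra of `CU_A`. -/
noncomputable abbrev commutatorLie : Submodule ℂ A :=
  unitaryLie (closedCommutatorUnitary A) isClosed_closedCommutatorUnitary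

theorem commutator_mem_commutatorLie (a b : A) : a * b - b * a ∈ commutatorLie A := by
  have key : ∀ x : selfAdjoint A, (x : A) * b - b * x ∈ commutatorLie A := by
    refine fun x => commutator_mem_of_conj_sub_mem (W := commutatorLie A) isClosed_unitaryLie
      fun t z => ?_
    set u := expUnitary (t • x)
    rw [smul_sub, map_sub, sub_eq_add_neg]
    refine isClosed_closedCommutatorUnitary.mem_of_tendsto (tendsto_trotter _ _)
      (.of_forall fun n => Subgroup.pow_mem _ ?_ n)
    rw [smul_neg, ← realPart_real_smul_smul, ← realPart_real_smul_smul, expUnitary_neg,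
      expUnitary_conj u (coe_realPart_smul_conj u _ b)]
    exact commutatorElement_mem_closedCommutatorUnitary (expUnitary_mem_unitaryComponent _)
      (expUnitary_mem_unitaryComponent _)
  exact commutator_mem_of_realPart_imaginaryPart (key _) (key _)

end Component

/-! ### Commutators and semiprimeness -/

section Semiprime

open Filter Topology NormedSpace selfAdjoint
open scoped ComplexStarModule

/-- In a semiprime ring, an element commuting with all commutators is central. -/
theorem commute_of_commute_commutators {R : Type*} [Ring R]
    (hR : ∀ y : R, (∀ c, y * c * y = 0) → y = 0) {u : R}
    (hu : ∀ a b : R, u * (a * b - b * a) = (a * b - b * a) * u) (a : R) : u * a = a * u := by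
  have h1 : ∀ b : R, (a * b - b * a) * (u * a - a * u) = 0 := by
    intro b
    have e1 := hu a b
    have e2 := hu a (b * a)
    have e : (a * b - b * a) * (u * a - a * u)
        = ((a * b - b * a) * u - u * (a * b - b * a)) * a
          + (u * (a * (b * a) - b * a * a) - (a * (b * a) - b * a * a) * u) := by noncomm_ring
    rw [e, e1, e2]; simp
  refine sub_eq_zero.1 (hR _ fun c => ?_)
  have e : (u * a - a * u) * c * (u * a - a * u)
      = u * ((a * c - c * a) * (u * a - a * u)) - (a * (u * c) - u * c * a) * (u * a - a * u) := by
    noncomm_ring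
  rw [e, h1, h1]; simp

variable {A : Type*} [CStarAlgebra A]

/-- Closed two-sided ideals of C⋆-algebras are semiprime. With `h = y⋆y`, the ideal contains
`y h = y y⋆ y`, and `y` is the limit of `y h (h + ε)⁻¹` as `ε → 0`. -/
theorem mem_of_forall_mul_mul_mem {I : Ideal A} [I.IsTwoSided] (hI : IsClosed (I : Set A)) {y : A}
    (h : ∀ c, y * c * y ∈ I) : y ∈ I := by
  let := CStarAlgebra.spectralOrder A
  have := CStarAlgebra.spectralOrderedRing A
  rw [← SetLike.mem_coe, ← hI.closure_eq, Metric.mem_closure_iff]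
  intro δ hδ
  set p := star y * y with hp
  have hpsa : IsSelfAdjoint p := IsSelfAdjoint.star_mul_self y
  have hsp : ∀ t ∈ spectrum ℝ p, 0 ≤ t := fun t ht =>
    spectrum_nonneg_of_nonneg (star_mul_self_nonneg y) ht
  set ε := δ ^ 2 / 4 with hε
  have hε0 : 0 < ε := by positivity
  have hc : ContinuousOn (fun t : ℝ => (t + ε)⁻¹) (spectrum ℝ p) :=
    ContinuousOn.inv₀ (by fun_prop) fun t ht => by have := hsp t ht; positivity
  have hcε : ContinuousOn (fun t : ℝ => ε * (t + ε)⁻¹) (spectrum ℝ p) :=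
    continuousOn_const.mul hc
  set k := cfc (fun t : ℝ => ε * (t + ε)⁻¹) p with hk
  set g := cfc (fun t : ℝ => (t + ε)⁻¹) p with hg
  have hkg : k = 1 - p * g := by
    have e1 : p * g = cfc (fun t : ℝ => t * (t + ε)⁻¹) p := by
      rw [cfc_mul (fun t : ℝ => t) _ p continuousOn_id hc, cfc_id' ℝ p]
    rw [e1, ← cfc_one ℝ p, ← cfc_sub (1 : ℝ → ℝ) (fun t : ℝ => t * (t + ε)⁻¹) p
      continuousOn_const (continuousOn_id.mul hc)]
    refine cfc_congr fun t ht => ?_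
    have := hsp t ht
    have : t + ε ≠ 0 := by positivity
    simp only [Pi.one_apply]
    field_simp
    ring
  refine ⟨y * p * g, I.mul_mem_right _ ?_, ?_⟩
  · rw [hp, ← mul_assoc]; exact h _
  · have e : y - y * p * g = y * k := by rw [hkg]; noncomm_ring
    rw [dist_eq_norm, e]
    have hks : star k = k := (cfc_predicate (fun t : ℝ => ε * (t + ε)⁻¹) p).star_eq
    have e2 : star (y * k) * (y * k)
        = cfc (fun t : ℝ => ε * (t + ε)⁻¹ * t * (ε * (t + ε)⁻¹)) p := by
      rw [cfc_mul (fun t : ℝ => ε * (t + ε)⁻¹ * t) (fun t : ℝ => ε * (t + ε)⁻¹) p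
        (hcε.mul continuousOn_id) hcε,
        cfc_mul (fun t : ℝ => ε * (t + ε)⁻¹) (fun t : ℝ => t) p hcε continuousOn_id,
        cfc_id' ℝ p, star_mul, hks, ← hk]
      change k * star y * (y * k) = k * (star y * y) * k
      simp only [mul_assoc]
    have hn : ‖y * k‖ ^ 2 ≤ ε := by
      rw [sq, ← CStarRing.norm_star_mul_self, e2]
      refine norm_cfc_le hε0.le fun t ht => ?_
      have h0 := hsp t ht
      rw [Real.norm_of_nonneg (by positivity)]
      have : ε * (t + ε)⁻¹ * t * (ε * (t + ε)⁻¹) = ε * (ε * t / (t + ε) ^ 2) := by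
        field_simp
      rw [this]
      refine mul_le_of_le_one_right hε0.le ((div_le_one (by positivity)).2 ?_)
      nlinarith [sq_nonneg t, sq_nonneg ε, mul_nonneg hε0.le h0]
    have : ‖y * k‖ ^ 2 < δ ^ 2 := by
      refine hn.trans_lt ?_
      rw [hε]; nlinarith [sq_nonneg δ, pow_pos hδ 2]
    exact lt_of_pow_lt_pow_left₀ 2 hδ.le this

theorem eq_zero_of_forall_mul_mul_eq_zero {y : A} (h : ∀ c, y * c * y = 0) : y = 0 := by
  have : (⊥ : Ideal A).IsTwoSided := inferInstance
  simpa using mem_of_forall_mul_mul_mem (I := (⊥ : Ideal A)) (y := y)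
    (by simp) (by simpa using h)

/-- The quotient by a closed two-sided ideal is commutative as soon as its commutators commute with
each other. -/
theorem quotient_commutative_of_commute_commutators {I : Ideal A} [I.IsTwoSided]
    (hI : IsClosed (I : Set A))
    (h : ∀ a b c d : A, (a * b - b * a) * (c * d - d * c) - (c * d - d * c) * (a * b - b * a) ∈ I)
    (x y : A ⧸ I) : x * y = y * x := by
  have hs : ∀ y : A ⧸ I, (∀ c, y * c * y = 0) → y = 0 := by
    intro y
    obtain ⟨y, rfl⟩ := Ideal.Quotient.mk_surjective y
    intro hy
    refine Ideal.Quotient.eq_zero_iff_mem.2 (mem_of_forall_mul_mul_mem hI fun c => ?_)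
    rw [← Ideal.Quotient.eq_zero_iff_mem, map_mul, map_mul]
    exact hy _
  have hq : ∀ a b c d : A ⧸ I,
      (a * b - b * a) * (c * d - d * c) = (c * d - d * c) * (a * b - b * a) := by
    intro a b c d
    obtain ⟨a, rfl⟩ := Ideal.Quotient.mk_surjective a
    obtain ⟨b, rfl⟩ := Ideal.Quotient.mk_surjective b
    obtain ⟨c, rfl⟩ := Ideal.Quotient.mk_surjective c
    obtain ⟨d, rfl⟩ := Ideal.Quotient.mk_surjective d
    simp only [← map_mul, ← map_sub]
    exact Ideal.Quotient.eq.2 (h a b c d)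
  refine commute_of_commute_commutators hs (fun a b => ?_) y
  -- a commutator commutes with all commutators, hence is central
  exact (commute_of_commute_commutators hs (fun c d => hq a b c d) x).symm

end Semiprime

/-! ### Subspaces invariant under bracketing with commutators -/

section LieIdeal

open Filter Topology NormedSpace selfAdjoint
open scoped ComplexStarModule

variable {A : Type*} [CStarAlgebra A]

/-- The elements whose commutators with all of `A` lie in `V`. -/
def commutatorTransporter (V : Submodule ℂ A) : Submodule ℂ A where
  carrier := {x | ∀ a, x * a - a * x ∈ V}
  zero_mem' a := by simp
  add_mem' {x y} hx hy a := by
    rw [show (x + y) * a - a * (x + y) = (x * a - a * x) + (y * a - a * y) by noncomm_ring]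
    exact V.add_mem (hx a) (hy a)
  smul_mem' c x hx a := by
    rw [smul_mul_assoc, mul_smul_comm, ← smul_sub]
    exact V.smul_mem c (hx a)

/-- The largest two-sided ideal contained in the subspace `T`. -/
def largestIdeal (T : Submodule ℂ A) : Ideal A where
  carrier := {x | ∀ a b, a * x * b ∈ T}
  zero_mem' a b := by simp
  add_mem' {x y} hx hy a b := by
    rw [mul_add, add_mul]
    exact T.add_mem (hx a b) (hy a b)
  smul_mem' c x hx a b := by
    rw [smul_eq_mul, ← mul_assoc]
    exact hx (a * c) b

instance largestIdeal_isTwoSided (T : Submodule ℂ A) : (largestIdeal T).IsTwoSided :=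
  ⟨fun c hx a b => by rw [← mul_assoc, mul_assoc]; exact hx a (c * b)⟩

theorem largestIdeal_subset {T : Submodule ℂ A} {x : A} (hx : x ∈ largestIdeal T) : x ∈ T := by
  simpa using hx 1 1

theorem isClosed_largestIdeal {T : Submodule ℂ A} (hT : IsClosed (T : Set A)) :
    IsClosed (largestIdeal T : Set A) := by
  have : (largestIdeal T : Set A) = ⋂ a : A, ⋂ b : A, (fun x => a * x * b) ⁻¹' (T : Set A) := by
    ext x; simp [largestIdeal]
  rw [this]
  exact isClosed_iInter fun a => isClosed_iInter fun b => hT.preimage (by fun_prop)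

variable {V : Submodule ℂ A}

theorem isClosed_commutatorTransporter (hV : IsClosed (V : Set A)) :
    IsClosed (commutatorTransporter V : Set A) := by
  have : (commutatorTransporter V : Set A) =
      ⋂ a : A, (fun x => x * a - a * x) ⁻¹' (V : Set A) := by
    ext x; simp [commutatorTransporter]
  rw [this]
  exact isClosed_iInter fun a => hV.preimage (by fun_prop)

theorem mul_mem_commutatorTransporter {x y : A} (hx : x ∈ commutatorTransporter V)
    (hy : y ∈ commutatorTransporter V) : x * y ∈ commutatorTransporter V := by
  intro a
  rw [show x * y * a - a * (x * y) = (x * (y * a) - y * a * x) + (y * (a * x) - a * x * y) by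
    noncomm_ring]
  exact V.add_mem (hx _) (hy _)

theorem star_mem_commutatorTransporter (hV : ∀ x ∈ V, star x ∈ V) {x : A}
    (hx : x ∈ commutatorTransporter V) : star x ∈ commutatorTransporter V := by
  intro a
  have := V.neg_mem (hV _ (hx (star a)))
  simpa using this

theorem commutator_mem_commutatorTransporter
    (hD : ∀ a b : A, ∀ x ∈ V, (a * b - b * a) * x - x * (a * b - b * a) ∈ V) {x y : A}
    (hx : x ∈ V) (hy : y ∈ V) : x * y - y * x ∈ commutatorTransporter V := by
  intro a
  have h1 := hD y a x hx
  have h2 := hD x a y hy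
  rw [show (x * y - y * x) * a - a * (x * y - y * x)
      = ((x * a - a * x) * y - y * (x * a - a * x)) - ((y * a - a * y) * x - x * (y * a - a * y)) by
    noncomm_ring]
  exact V.sub_mem h2 h1

theorem invariant_commutatorTransporter
    (hD : ∀ a b : A, ∀ x ∈ V, (a * b - b * a) * x - x * (a * b - b * a) ∈ V) (a b : A) {x : A}
    (hx : x ∈ commutatorTransporter V) :
    (a * b - b * a) * x - x * (a * b - b * a) ∈ commutatorTransporter V := by
  intro c
  have h1 := hD a b _ (hx c)
  have h2 := hx ((a * b - b * a) * c - c * (a * b - b * a))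
  rw [show ((a * b - b * a) * x - x * (a * b - b * a)) * c
        - c * ((a * b - b * a) * x - x * (a * b - b * a))
      = ((a * b - b * a) * (x * c - c * x) - (x * c - c * x) * (a * b - b * a))
        - (x * ((a * b - b * a) * c - c * (a * b - b * a))
          - ((a * b - b * a) * c - c * (a * b - b * a)) * x) by noncomm_ring]
  exact V.sub_mem h1 h2

/-- If a selfadjoint `x` commutes with every `[x, [x, d]]`, `d` a commutator, it is central. -/
theorem commute_of_commute_double_commutator {x : A} (hx : IsSelfAdjoint x)
    (h : ∀ a b : A, x * (x * (x * (a * b - b * a) - (a * b - b * a) * x)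
        - (x * (a * b - b * a) - (a * b - b * a) * x) * x)
      = (x * (x * (a * b - b * a) - (a * b - b * a) * x)
        - (x * (a * b - b * a) - (a * b - b * a) * x) * x) * x) (c : A) : x * c = c * x := by
  refine commute_of_commute_commutators (fun _ => eq_zero_of_forall_mul_mul_eq_zero)
    (fun a b => ?_) c
  exact commute_of_commute_commutator hx (commute_of_commute_commutator hx (h a b))

theorem exists_isSelfAdjoint_not_commute {W : Submodule ℂ A} (hW : ∀ x ∈ W, star x ∈ W)
    {x c : A} (hx : x ∈ W) (hc : x * c ≠ c * x) :
    ∃ y ∈ W, IsSelfAdjoint y ∧ ∃ d, y * d ≠ d * y := by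
  by_contra! hcon
  have h1 := hcon _ (realPart_mem_of_star_mem hW hx) (ℜ x).2 c
  have h2 := hcon _ (imaginaryPart_mem_of_star_mem hW hx) (ℑ x).2 c
  apply hc
  rw [← realPart_add_I_smul_imaginaryPart x, add_mul, mul_add, h1, smul_mul_assoc, h2,
    mul_smul_comm]

/-- A noncommutative subalgebra `T` invariant under bracketing with commutators contains a nonzero
two-sided ideal: if `p = [s, t]` with `s, t ∈ T`, then `p A p ⊆ T`, `A p⁵ ⊆ T` and `p⁵ A ⊆ T`. -/
theorem pow_mem_largestIdeal {T : Submodule ℂ A} (hm : ∀ x ∈ T, ∀ y ∈ T, x * y ∈ T)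
    (hD : ∀ a b : A, ∀ x ∈ T, (a * b - b * a) * x - x * (a * b - b * a) ∈ T) {s t : A}
    (hs : s ∈ T) (ht : t ∈ T) : (s * t - t * s) ^ 10 ∈ largestIdeal T := by
  have hp : s * t - t * s ∈ T := T.sub_mem (hm _ hs _ ht) (hm _ ht _ hs)
  -- `[s, t] [t, a]` arises from bracketing `s` with the commutator `t [t, a] = [t, t a]`
  have h1 : ∀ a : A, (s * t - t * s) * (t * a - a * t) ∈ T := by
    intro a
    have e1 := hD t (t * a) s hs
    have e2 := hm _ ht _ (hD t a s hs)
    rw [show (s * t - t * s) * (t * a - a * t)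
      = t * ((t * a - a * t) * s - s * (t * a - a * t))
        - ((t * (t * a) - t * a * t) * s - s * (t * (t * a) - t * a * t)) by noncomm_ring]
    exact T.sub_mem e2 e1
  -- compare the previous statement for `a s` with its product by `s`
  have h2 : ∀ a : A, (s * t - t * s) * a * (s * t - t * s) ∈ T := by
    intro a
    have e1 := h1 (a * s)
    have e2 := hm _ (h1 a) _ hs
    rw [show (s * t - t * s) * a * (s * t - t * s)
      = (s * t - t * s) * (t * a - a * t) * s
        - (s * t - t * s) * (t * (a * s) - a * s * t) by noncomm_ring]
    exact T.sub_mem e2 e1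
  generalize s * t - t * s = p at hp h2
  have hp2 : p ^ 2 ∈ T := by rw [sq]; exact hm _ hp _ hp
  -- all terms of `[[p, y p²], p²]` other than `y p⁵` lie in `p A p`
  have h3 : ∀ y : A, y * p ^ 5 ∈ T := by
    intro y
    have e := hD p (y * p ^ 2) _ hp2
    rw [show y * p ^ 5 = p * (y * p ^ 3) * p - p * (p ^ 2 * y * p) * p + p * (p * y * p ^ 2) * p
        - ((p * (y * p ^ 2) - y * p ^ 2 * p) * p ^ 2
          - p ^ 2 * (p * (y * p ^ 2) - y * p ^ 2 * p)) by noncomm_ring]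
    exact T.sub_mem (T.add_mem (T.sub_mem (h2 _) (h2 _)) (h2 _)) e
  have h4 : ∀ y : A, p ^ 5 * y ∈ T := by
    intro y
    have e := hD p (p ^ 2 * y) _ hp2
    rw [show p ^ 5 * y = p * (p ^ 2 * y * p) * p - p * (p * y * p ^ 2) * p + p * (p ^ 3 * y) * p
        - ((p * (p ^ 2 * y) - p ^ 2 * y * p) * p ^ 2
          - p ^ 2 * (p * (p ^ 2 * y) - p ^ 2 * y * p)) by noncomm_ring]
    exact T.sub_mem (T.add_mem (T.sub_mem (h2 _) (h2 _)) (h2 _)) e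
  intro a b
  rw [show a * p ^ 10 * b = a * p ^ 5 * (p ^ 5 * b) by noncomm_ring]
  exact hm _ (h3 a) _ (h4 b)

theorem eq_zero_of_star_eq_neg_of_pow_eq_zero {p : A} (hp : star p = -p) {n : ℕ}
    (h : p ^ n = 0) : p = 0 := by
  have key : ∀ k : ℕ, p ^ 2 ^ k = 0 → p = 0 := by
    intro k
    induction k with
    | zero => simp
    | succ k ih =>
      intro hk
      refine ih ((CStarRing.star_mul_self_eq_zero_iff _).1 ?_)
      rw [pow_succ, mul_two, pow_add] at hk
      rw [star_pow, hp, neg_pow, mul_assoc, hk, mul_zero]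
  exact key n (pow_eq_zero_of_le Nat.lt_two_pow_self.le h)

/-- A ⋆-invariant subspace that is invariant under bracketing with commutators and not contained in
the center contains `[I, A]` for some nonzero two-sided ideal `I`. -/
theorem largestIdeal_commutatorTransporter_ne_bot (hs : ∀ x ∈ V, star x ∈ V)
    (hD : ∀ a b : A, ∀ x ∈ V, (a * b - b * a) * x - x * (a * b - b * a) ∈ V) {x c : A}
    (hx : x ∈ V) (hc : x * c ≠ c * x) : largestIdeal (commutatorTransporter V) ≠ ⊥ := by
  set T := commutatorTransporter V with hT
  have hTs : ∀ x ∈ T, star x ∈ T := fun x => star_mem_commutatorTransporter hs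
  have hTD : ∀ a b : A, ∀ x ∈ T, (a * b - b * a) * x - x * (a * b - b * a) ∈ T :=
    fun a b x => invariant_commutatorTransporter hD a b
  -- `T` is not central
  obtain ⟨y, hyT, hysa, d, hyd⟩ : ∃ y ∈ T, IsSelfAdjoint y ∧ ∃ d, y * d ≠ d * y := by
    obtain ⟨y, hy, hysa, d, hyd⟩ := exists_isSelfAdjoint_not_commute hs hx hc
    by_contra! hcon
    have hcen : ∀ t ∈ T, ∀ e, t * e = e * t := by
      intro t ht e
      by_contra hte
      obtain ⟨z, hz, hzs, f, hf⟩ := exists_isSelfAdjoint_not_commute hTs ht hte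
      exact hf (hcon z hz hzs f)
    refine hyd (commute_of_commute_double_commutator hysa (fun a b => ?_) d)
    refine (hcen _ (commutator_mem_commutatorTransporter hD hy ?_) y).symm
    have := V.neg_mem (hD a b y hy)
    rwa [neg_sub] at this
  -- `T` is not commutative
  obtain ⟨z, hzT, hzsa, hyz⟩ : ∃ z ∈ T, IsSelfAdjoint z ∧ y * z ≠ z * y := by
    by_contra! hcon
    have hcen : ∀ t ∈ T, y * t = t * y := by
      intro t ht
      rw [← realPart_add_I_smul_imaginaryPart t, mul_add, add_mul, mul_smul_comm, smul_mul_assoc,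
        hcon _ (realPart_mem_of_star_mem hTs ht) (ℜ t).2,
        hcon _ (imaginaryPart_mem_of_star_mem hTs ht) (ℑ t).2]
    refine hyd (commute_of_commute_double_commutator hysa (fun a b => ?_) d)
    have h1 : y * (a * b - b * a) - (a * b - b * a) * y ∈ T := by
      have := T.neg_mem (hTD a b y hyT)
      rwa [neg_sub] at this
    rw [hcen _ h1, sub_self, mul_zero, zero_mul]
  intro hbot
  have hmem := pow_mem_largestIdeal (fun x hx y hy => mul_mem_commutatorTransporter hx hy) hTD
    hyT hzT
  rw [← hT, hbot, Ideal.mem_bot] at hmem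
  have hsk : star (y * z - z * y) = -(y * z - z * y) := by
    simp [hysa.star_eq, hzsa.star_eq]
  exact hyz (sub_eq_zero.1 (eq_zero_of_star_eq_neg_of_pow_eq_zero hsk hmem))

/-- If `V` is closed and contains `[I, A]` for an ideal `I` containing all commutators, it contains
all `u b u⋆ - b`: modulo `V`, the map `n ↦ uⁿ b u⁻ⁿ - b` is additive, and it is bounded. -/
theorem unitary_conj_sub_mem (hV : IsClosed (V : Set A)) {I : Ideal A} [I.IsTwoSided]
    (hI : ∀ x ∈ I, ∀ a, x * a - a * x ∈ V) (hc : ∀ a b : A, a * b - b * a ∈ I)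
    (u : unitary A) (b : A) : (u : A) * b * star (u : A) - b ∈ V := by
  set j := (u : A) * b * star (u : A) - b with hj
  have hjI : j ∈ I := by
    have e : j = ((u : A) * b) * star (u : A) - star (u : A) * ((u : A) * b) := by
      rw [← mul_assoc (star (u : A)), Unitary.coe_star_mul_self, one_mul]
    rw [e]; exact hc _ _
  have h1 : ∀ n : ℕ, ((u ^ n : unitary A) : A) * b * star ((u ^ n : unitary A) : A) - b
      - (n : ℂ) • j ∈ V := by
    intro n
    induction n with
    | zero => simp
    | succ k ih =>
      set w := u ^ k with hw
      have e : ((u ^ (k + 1) : unitary A) : A) * b * star ((u ^ (k + 1) : unitary A) : A) - b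
          - ((k + 1 : ℕ) : ℂ) • j
          = ((w : A) * b * star (w : A) - b - (k : ℂ) • j)
            - (j * star (w : A) * w - w * (j * star (w : A))) := by
        rw [mul_assoc j, Unitary.coe_star_mul_self, mul_one, pow_succ, ← hw, Submonoid.coe_mul,
          star_mul, hj]
        push_cast
        rw [add_smul, one_smul]
        noncomm_ring
      rw [e]
      exact V.sub_mem ih (hI _ (I.mul_mem_right _ hjI) _)
  have h2 : Tendsto (fun n : ℕ => ((n : ℂ)⁻¹) • (((u ^ n : unitary A) : A) * b *
      star ((u ^ n : unitary A) : A) - b)) atTop (𝓝 0) := by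
    rw [tendsto_zero_iff_norm_tendsto_zero]
    have hz : Tendsto (fun n : ℕ => (n : ℝ)⁻¹ * (2 * ‖b‖)) atTop (𝓝 0) := by
      simpa using tendsto_inv_atTop_nhds_zero_nat.mul_const (2 * ‖b‖)
    refine squeeze_zero (fun _ => norm_nonneg _) (fun n => ?_) hz
    rw [norm_smul, norm_inv, Complex.norm_natCast]
    refine mul_le_mul_of_nonneg_left ((norm_sub_le _ _).trans ?_) (by positivity)
    rw [← Unitary.coe_star, CStarRing.norm_mul_coe_unitary, CStarRing.norm_coe_unitary_mul]
    linarith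
  have h3 : -j ∈ (V : Set A) := by
    have ht := h2.sub_const j
    rw [zero_sub] at ht
    refine hV.mem_of_tendsto ht ?_
    filter_upwards [eventually_gt_atTop 0] with n hn
    have hn' : (n : ℂ) ≠ 0 := by exact_mod_cast hn.ne'
    have := V.smul_mem ((n : ℂ)⁻¹) (h1 n)
    rwa [smul_sub, smul_smul, inv_mul_cancel₀ hn', one_smul] at this
  simpa using V.neg_mem h3

end LieIdeal

/-! ### Closed normal subgroups of `CU_A` -/

section NormalSubgroups

open Filter Topology NormedSpace selfAdjoint
open scoped ComplexStarModule

variable {A : Type*} [CStarAlgebra A]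

theorem isClosed_normalCore {Γ : Type*} [Group Γ] [TopologicalSpace Γ] [ContinuousMul Γ]
    {N : Subgroup Γ} (hN : IsClosed (N : Set Γ)) : IsClosed (N.normalCore : Set Γ) := by
  have : (N.normalCore : Set Γ) = ⋂ b : Γ, (fun a => b * a * b⁻¹) ⁻¹' (N : Set Γ) := by
    ext a
    simp only [Set.mem_iInter]
    rfl
  rw [this]
  exact isClosed_iInter fun b => hN.preimage (by fun_prop)

/-- If the Lie algebra of `N` contains all `u b u⋆ - b`, then `N` contains the commutators of
unitaries with exponentials. The argument runs in the normal core `M` of `N`: modulo `M`,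
Trotter's formula for `u x u⋆ = x + (u x u⋆ - x)` shows that `exp(i u x u⋆)` equals `exp(i x)`. -/
theorem closedCommutatorUnitary_le_of_conj_sub_mem {N : Subgroup (unitary A)}
    (hN : IsClosed (N : Set (unitary A)))
    (h : ∀ (u : unitary A) (b : A), (u : A) * b * star (u : A) - b ∈ unitaryLie N hN) :
    closedCommutatorUnitary A ≤ N := by
  have hM := isClosed_normalCore hN
  have h' : ∀ (u : unitary A) (b : A),
      (u : A) * b * star (u : A) - b ∈ unitaryLie N.normalCore hM := by
    intro u b z w
    rw [← expUnitary_conj w (coe_realPart_smul_conj w z _)]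
    have e : (w : A) * ((u : A) * b * star (u : A) - b) * star (w : A)
        = (((w * u : unitary A) : A) * b * star ((w * u : unitary A) : A) - b)
          - ((w : A) * b * star (w : A) - b) := by
      simp only [Submonoid.coe_mul, star_mul]; noncomm_ring
    have hm := Submodule.sub_mem _ (h (w * u) b) (h w b)
    rw [← e] at hm
    exact hm z
  let π := QuotientGroup.mk' N.normalCore
  have hπ : ∀ g, π g = 1 ↔ g ∈ N.normalCore := fun g => QuotientGroup.eq_one_iff g
  have key : ∀ (u : unitary A) (x : selfAdjoint A),
      u * expUnitary x * u⁻¹ * (expUnitary x)⁻¹ ∈ N.normalCore := by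
    intro u x
    let y : selfAdjoint A := ⟨(u : A) * x * star (u : A), x.2.conjugate _⟩
    have hy : expUnitary y = u * expUnitary x * u⁻¹ := expUnitary_conj u rfl
    have ht := (tendsto_trotter x (y - x)).mul_const (expUnitary x)⁻¹
    rw [add_sub_cancel, hy] at ht
    refine hM.mem_of_tendsto ht ?_
    filter_upwards [eventually_gt_atTop 0] with n hn
    have hn' : (n : ℝ) ≠ 0 := by positivity
    have e : expUnitary x = expUnitary ((n : ℝ)⁻¹ • x) ^ n := by
      rw [← expUnitary_nsmul, ← Nat.cast_smul_eq_nsmul ℝ, smul_smul, mul_inv_cancel₀ hn', one_smul]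
    have hc : expUnitary ((n : ℝ)⁻¹ • (y - x)) ∈ N.normalCore := by
      refine expUnitary_mem_of_mem_unitaryLie (hH := hM) ?_
      rw [selfAdjoint.val_smul, ← Complex.coe_smul]
      exact Submodule.smul_mem _ _ (h' u x)
    rw [SetLike.mem_coe, ← hπ, map_mul, map_inv, map_pow, map_mul, (hπ _).2 hc, mul_one,
      ← map_pow, ← e, mul_inv_cancel]
  have hU : unitaryComponent A ≤ (Subgroup.center _).comap π := by
    refine unitaryComponent_le fun x => Subgroup.mem_comap.2 (Subgroup.mem_center_iff.2 fun g => ?_)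
    obtain ⟨u, rfl⟩ := QuotientGroup.mk'_surjective _ g
    have := (hπ _).2 (key u x)
    rw [map_mul, map_inv, mul_inv_eq_one, map_mul, map_inv, mul_inv_eq_iff_eq_mul] at this
    exact this
  refine (Subgroup.topologicalClosure_minimal _ ?_ hM).trans N.normalCore_le
  refine Subgroup.commutator_le.2 fun u hu v hv => ?_
  rw [← hπ, map_commutatorElement, commutatorElement_eq_one_iff_mul_comm]
  exact (Subgroup.mem_center_iff.1 (Subgroup.mem_comap.1 (hU hu)) _).symm

/-- A unitary moves no element by a nonzero central one: iterating would be unbounded. -/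
theorem conj_eq_of_conj_sub_central {u : unitary A} {d : A}
    (h : ∀ a, ((u : A) * d * star (u : A) - d) * a = a * ((u : A) * d * star (u : A) - d)) :
    (u : A) * d * star (u : A) = d := by
  set c := (u : A) * d * star (u : A) - d with hc
  have hb : ∀ n : ℕ, ((u ^ n : unitary A) : A) * d * star ((u ^ n : unitary A) : A)
      = d + (n : ℝ) • c := by
    intro n
    induction n with
    | zero => simp
    | succ k ih =>
      have e : ((u ^ (k + 1) : unitary A) : A) * d * star ((u ^ (k + 1) : unitary A) : A)
          = u * (((u ^ k : unitary A) : A) * d * star ((u ^ k : unitary A) : A))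
            * star (u : A) := by
        rw [pow_succ', Submonoid.coe_mul, star_mul]; simp only [mul_assoc]
      rw [e, ih, mul_add, add_mul, mul_smul_comm, smul_mul_assoc, ← h, mul_assoc c,
        Unitary.mul_star_self_of_mem u.2, mul_one,
        ← sub_add_cancel ((u : A) * d * star (u : A)) d, ← hc]
      push_cast
      rw [add_smul, one_smul]; abel
  have hn : ∀ n : ℕ, n * ‖c‖ ≤ 2 * ‖d‖ := by
    intro n
    have h1 : ‖(n : ℝ) • c‖ = n * ‖c‖ := by simp [norm_smul]
    rw [← h1, eq_sub_of_add_eq' (hb n).symm]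
    refine (norm_sub_le _ _).trans ?_
    rw [← Unitary.coe_star, CStarRing.norm_mul_coe_unitary, CStarRing.norm_coe_unitary_mul]
    linarith
  by_contra hne
  have hpos : 0 < ‖c‖ := norm_pos_iff.2 (sub_ne_zero.2 hne)
  obtain ⟨n, hn'⟩ := exists_nat_gt (2 * ‖d‖ / ‖c‖)
  rw [div_lt_iff₀ hpos] at hn'
  linarith [hn n]

theorem commute_of_conj_eq {u : unitary A} {d : A} (h : (u : A) * d * star (u : A) = d) :
    (u : A) * d = d * u := by
  conv_rhs => rw [← h]
  rw [mul_assoc, Unitary.coe_star_mul_self, mul_one]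

theorem conj_sub_eq_zero_of_commute {u v : unitary A} (h : v * u = u * v) :
    (u : A) * v * star (u : A) - v = 0 := by
  rw [← Submonoid.coe_mul, ← h, Submonoid.coe_mul, mul_assoc,
    Unitary.mul_star_self_of_mem u.2, mul_one, sub_self]

/-- If all proper quotients of `A` are abelian, every closed subgroup of the unitary group that is
normalized by `CU_A` and contains a noncentral element of `A` contains `CU_A`. -/
theorem closedCommutatorUnitary_le {N : Subgroup (unitary A)}
    (hA : AllProperQuotientsAbelian A) (hN : IsClosed (N : Set (unitary A)))
    (hn : ∀ k ∈ closedCommutatorUnitary A, ∀ h ∈ N, k * h * k⁻¹ ∈ N)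
    {u : unitary A} (hu : u ∈ N) {c : A} (hc : (u : A) * c ≠ c * u) :
    closedCommutatorUnitary A ≤ N := by
  set V := unitaryLie N hN with hVdef
  have hV : IsClosed (V : Set A) := isClosed_unitaryLie
  have hD : ∀ a b : A, ∀ x ∈ V, (a * b - b * a) * x - x * (a * b - b * a) ∈ V :=
    fun a b x hx => commutator_mem_unitaryLie hn (commutator_mem_commutatorLie a b) hx
  -- the Lie algebra of `N` is not central
  obtain ⟨x, hx, e, hxe⟩ : ∃ x ∈ V, ∃ e, x * e ≠ e * x := by
    by_contra! hcon
    refine hc (commute_of_commute_commutators (fun _ => eq_zero_of_forall_mul_mul_eq_zero)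
      (fun a b => commute_of_conj_eq (conj_eq_of_conj_sub_central (hcon _ ?_))) c)
    exact conj_sub_mem_unitaryLie hn (commutator_mem_commutatorLie a b) hu
  have hI := largestIdeal_commutatorTransporter_ne_bot (fun _ => star_mem_unitaryLie) hD hx hxe
  have hab := hA _ (isClosed_largestIdeal (isClosed_commutatorTransporter hV)) hI
  refine closedCommutatorUnitary_le_of_conj_sub_mem hN fun u b =>
    unitary_conj_sub_mem hV (I := largestIdeal (commutatorTransporter V))
      (fun x hx => largestIdeal_subset hx) (fun a b => ?_) u b
  have := hab (Ideal.Quotient.mk _ a) (Ideal.Quotient.mk _ b)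
  rw [← map_mul, ← map_mul] at this
  exact Ideal.Quotient.eq.1 this

/-- A unitary commuting with `CU_A` commutes with all commutators, hence is central. -/
theorem central_of_commute_closedCommutatorUnitary {u : unitary A}
    (hu : ∀ v ∈ closedCommutatorUnitary A, u * v = v * u) (a : A) : (u : A) * a = a * u := by
  refine commute_of_commute_commutators (fun _ => eq_zero_of_forall_mul_mul_eq_zero)
    (fun a b => ?_) a
  have := commutator_mem_of_forall_conj_sub_mem (W := (⊥ : Submodule ℂ A)) (by simp) (b := (u : A))
    (fun k hk => (Submodule.mem_bot ℂ).2 (conj_sub_eq_zero_of_commute (hu k hk)))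
    (commutator_mem_commutatorLie a b)
  exact (sub_eq_zero.1 ((Submodule.mem_bot ℂ).1 this)).symm

/-- A unitary commuting with `U_A` is central: the Lie algebra of `U_A` is all of `A`. -/
theorem central_of_commute_unitaryComponent {u : unitary A}
    (hu : ∀ v ∈ unitaryComponent A, u * v = v * u) (a : A) : (u : A) * a = a * u := by
  have := commutator_mem_of_forall_conj_sub_mem (W := (⊥ : Submodule ℂ A)) (by simp) (b := (u : A))
    (fun k hk => (Submodule.mem_bot ℂ).2 (conj_sub_eq_zero_of_commute (hu k hk)))
    (d := a) (hK := isClosed_unitaryComponent) (fun z => expUnitary_mem_unitaryComponent _)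
  exact (sub_eq_zero.1 ((Submodule.mem_bot ℂ).1 this)).symm

theorem isTopologicallySimple_of_allProperQuotientsAbelian (hA : AllProperQuotientsAbelian A) :
    IsTopologicallySimple
      (closedCommutatorUnitary A ⧸ Subgroup.center (closedCommutatorUnitary A)) := by
  intro N hNn hNc
  set M := (N.comap (QuotientGroup.mk' (Subgroup.center (closedCommutatorUnitary A)))).map
    (closedCommutatorUnitary A).subtype with hM
  have hMc : IsClosed (M : Set (unitary A)) := by
    rw [hM, Subgroup.coe_map]
    exact (isClosed_closedCommutatorUnitary.isClosedEmbedding_subtypeVal).isClosedMap _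
      (hNc.preimage QuotientGroup.continuous_mk)
  have hMn : ∀ k ∈ closedCommutatorUnitary A, ∀ h ∈ M, k * h * k⁻¹ ∈ M := by
    rintro k hk _ ⟨h, hh, rfl⟩
    exact ⟨⟨k, hk⟩ * h * ⟨k, hk⟩⁻¹, (hNn.comap _).conj_mem _ hh _, rfl⟩
  by_cases hcen : ∃ u ∈ M, ∃ c : A, (u : A) * c ≠ c * u
  · obtain ⟨u, hu, c, hc⟩ := hcen
    have hle := closedCommutatorUnitary_le hA hMc hMn hu hc
    refine Or.inr (eq_top_iff.2 fun q _ => ?_)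
    obtain ⟨k, rfl⟩ := QuotientGroup.mk'_surjective _ q
    obtain ⟨k', hk', e⟩ := hle k.2
    rwa [← Subtype.ext e]
  · push Not at hcen
    refine Or.inl (eq_bot_iff.2 fun q hq => ?_)
    obtain ⟨k, rfl⟩ := QuotientGroup.mk'_surjective _ q
    refine Subgroup.mem_bot.2 ((QuotientGroup.eq_one_iff k).2
      (Subgroup.mem_center_iff.2 fun v => ?_))
    exact Subtype.ext (Subtype.ext (hcen k ⟨k, hq, rfl⟩ (v : unitary A)).symm)

end NormalSubgroups

/-! ### From topological simplicity to abelian quotients -/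

section Converse

open Filter Topology NormedSpace selfAdjoint
open scoped ComplexStarModule

variable {A : Type*} [CStarAlgebra A]

theorem expUnitary_sub_one_mem {I : Ideal A} (hI : IsClosed (I : Set A)) {x : selfAdjoint A}
    (hx : (x : A) ∈ I) : (expUnitary x : A) - 1 ∈ I := by
  have h := exp_series_hasSum_exp' (𝕂 := ℂ) (Complex.I • (x : A))
  have h2 := (hasSum_nat_add_iff' 1).2 h
  simp only [Finset.range_one, Finset.sum_singleton, pow_zero, Nat.factorial_zero, Nat.cast_one,
    inv_one, one_smul] at h2
  rw [expUnitary_coe]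
  refine hI.mem_of_tendsto h2 (.of_forall fun s => I.sum_mem fun n _ => ?_)
  rw [smul_pow, smul_smul, pow_succ (x : A), ← smul_mul_assoc]
  exact I.mul_mem_left _ hx

theorem eq_zero_of_algebraMap_mem {I : Ideal A} (hI : I ≠ ⊤) {z : ℂ} (h : algebraMap ℂ A z ∈ I) :
    z = 0 := by
  by_contra hz
  exact hI (I.eq_top_of_isUnit_mem h ((IsUnit.mk0 z hz).map (algebraMap ℂ A)))

/-- The elements of `CU_A` that commute with `CU_A` modulo the ideal `I`. -/
def centralModulo (I : Ideal A) [I.IsTwoSided] : Subgroup (closedCommutatorUnitary A) where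
  carrier := {u | ∀ v : closedCommutatorUnitary A,
    Commute (Ideal.Quotient.mk I ((u : unitary A) : A)) (Ideal.Quotient.mk I ((v : unitary A) : A))}
  one_mem' v := by simp
  mul_mem' {u w} hu hw v := by simpa using (hu v).mul_left (hw v)
  inv_mem' {u} hu v := by
    have h1 : Ideal.Quotient.mk I ((u : unitary A) : A)
        * Ideal.Quotient.mk I (((u⁻¹ : closedCommutatorUnitary A) : unitary A) : A) = 1 := by
      rw [← map_mul, ← Submonoid.coe_mul, ← Subgroup.coe_mul, mul_inv_cancel]; simp
    have h2 : Ideal.Quotient.mk I (((u⁻¹ : closedCommutatorUnitary A) : unitary A) : A)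
        * Ideal.Quotient.mk I ((u : unitary A) : A) = 1 := by
      rw [← map_mul, ← Submonoid.coe_mul, ← Subgroup.coe_mul, inv_mul_cancel]; simp
    exact Commute.units_inv_left (u := ⟨_, _, h1, h2⟩) (hu v)

theorem mem_centralModulo_iff {I : Ideal A} [I.IsTwoSided] {u : closedCommutatorUnitary A} :
    u ∈ centralModulo I ↔ ∀ v : closedCommutatorUnitary A,
      ((u : unitary A) : A) * ((v : unitary A) : A) - ((v : unitary A) : A) * ((u : unitary A) : A)
        ∈ I := by
  refine forall_congr' fun v => ?_
  rw [← Ideal.Quotient.eq, map_mul, map_mul]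
  rfl

theorem isClosed_centralModulo {I : Ideal A} [I.IsTwoSided] (hI : IsClosed (I : Set A)) :
    IsClosed (centralModulo I : Set (closedCommutatorUnitary A)) := by
  have : (centralModulo I : Set (closedCommutatorUnitary A)) =
      ⋂ v : closedCommutatorUnitary A, (fun u : closedCommutatorUnitary A =>
        ((u : unitary A) : A) * ((v : unitary A) : A)
          - ((v : unitary A) : A) * ((u : unitary A) : A)) ⁻¹' (I : Set A) := by
    ext u; simp [mem_centralModulo_iff]
  rw [this]
  exact isClosed_iInter fun v => hI.preimage (by fun_prop)

instance centralModulo_normal (I : Ideal A) [I.IsTwoSided] : (centralModulo I).Normal := by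
  refine ⟨fun u hu g v => ?_⟩
  have h1 : Ideal.Quotient.mk I ((g : unitary A) : A)
      * Ideal.Quotient.mk I (((g⁻¹ : closedCommutatorUnitary A) : unitary A) : A) = 1 := by
    rw [← map_mul, ← Submonoid.coe_mul, ← Subgroup.coe_mul, mul_inv_cancel]; simp
  have h2 : Ideal.Quotient.mk I (((g * u * g⁻¹ : closedCommutatorUnitary A) : unitary A) : A)
      = Ideal.Quotient.mk I ((u : unitary A) : A) := by
    rw [Subgroup.coe_mul, Subgroup.coe_mul, Submonoid.coe_mul, Submonoid.coe_mul, map_mul, map_mul,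
      ← (hu g).eq, mul_assoc, h1, mul_one]
  rw [h2]
  exact hu v

theorem center_le_centralModulo (I : Ideal A) [I.IsTwoSided] :
    Subgroup.center (closedCommutatorUnitary A) ≤ centralModulo I := by
  intro u hu
  refine mem_centralModulo_iff.2 fun v => ?_
  have h := congrArg (fun w : closedCommutatorUnitary A => ((w : unitary A) : A))
    (Subgroup.mem_center_iff.1 hu v)
  simp only [Subgroup.coe_mul, Submonoid.coe_mul] at h
  rw [h, sub_self]
  exact I.zero_mem

/-- If all elements of `CU_A` that are central modulo the proper ideal `I` are central, then
`I = 0`: for selfadjoint `y ∈ I` and `v ∈ U_A`, the commutator of `exp(ity)` and `v` is a scalar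
congruent to `1` modulo `I`, hence equal to `1`. -/
theorem eq_bot_of_centralModulo_le_center
    (hZ : ∀ a : A, (∀ b, a * b = b * a) → ∃ z : ℂ, a = algebraMap ℂ A z)
    {I : Ideal A} [I.IsTwoSided] (hI : IsClosed (I : Set A)) (htop : I ≠ ⊤)
    (h : centralModulo I ≤ Subgroup.center (closedCommutatorUnitary A)) : I = ⊥ := by
  have h1 : ∀ u ∈ closedCommutatorUnitary A, (u : A) - 1 ∈ I → u = 1 := by
    intro u hu huI
    have hq : Ideal.Quotient.mk I (u : A) = 1 := by
      rw [← map_one (Ideal.Quotient.mk I)]; exact Ideal.Quotient.eq.2 huI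
    have hmem : (⟨u, hu⟩ : closedCommutatorUnitary A) ∈ centralModulo I := by
      intro v
      change Commute (Ideal.Quotient.mk I (u : A)) _
      rw [hq]; exact Commute.one_left _
    obtain ⟨z, hz⟩ := hZ u (central_of_commute_closedCommutatorUnitary fun v hv =>
      (congrArg Subtype.val (Subgroup.mem_center_iff.1 (h hmem) ⟨v, hv⟩)).symm)
    rw [hz, ← map_one (algebraMap ℂ A), ← map_sub] at huI
    ext
    rw [hz, sub_eq_zero.1 (eq_zero_of_algebraMap_mem htop huI), map_one]; rfl
  have h2 : ∀ y : selfAdjoint A, (y : A) ∈ I → (y : A) = 0 := by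
    intro y hy
    have hcomm : ∀ t : ℝ, ∀ b, (expUnitary (t • y) : A) * b = b * expUnitary (t • y) := by
      refine fun t b => central_of_commute_unitaryComponent (fun v hv => ?_) b
      have hyt : ((t • y : selfAdjoint A) : A) ∈ I := by
        rw [selfAdjoint.val_smul, ← one_mul (y : A), ← smul_mul_assoc]
        exact I.mul_mem_left _ hy
      have hq : Ideal.Quotient.mk I (expUnitary (t • y) : A) = 1 := by
        rw [← map_one (Ideal.Quotient.mk I)]
        exact Ideal.Quotient.eq.2 (expUnitary_sub_one_mem hI hyt)
      generalize hg : expUnitary (t • y) = g at hq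
      have hgU : g ∈ unitaryComponent A := hg ▸ expUnitary_mem_unitaryComponent _
      have hq' : Ideal.Quotient.mk I ((g⁻¹ : unitary A) : A) = 1 := by
        rw [← mul_one (Ideal.Quotient.mk I _), ← hq, ← map_mul, ← Submonoid.coe_mul, inv_mul_cancel,
          OneMemClass.coe_one, map_one, hq]
      have := h1 _ (commutatorElement_mem_closedCommutatorUnitary hgU hv) (by
        rw [← Ideal.Quotient.eq_zero_iff_mem]
        simp only [Submonoid.coe_mul, map_mul, map_sub, map_one, hq, hq', one_mul, mul_one]
        rw [← map_mul, ← Submonoid.coe_mul, mul_inv_cancel, OneMemClass.coe_one, map_one, sub_self])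
      rwa [mul_inv_eq_one, mul_inv_eq_iff_eq_mul] at this
    obtain ⟨z, hz⟩ := hZ y fun b => by
      have := commutator_mem_of_conj_sub_mem (W := (⊥ : Submodule ℂ A)) (by simp) (x := y) (b := b)
        fun t => by
          rw [hcomm, mul_assoc, Unitary.mul_star_self_of_mem (expUnitary (t • y)).2, mul_one,
            sub_self]
          exact Submodule.zero_mem _
      exact sub_eq_zero.1 ((Submodule.mem_bot ℂ).1 this)
    rw [hz] at hy ⊢
    rw [eq_zero_of_algebraMap_mem htop hy, map_zero]
  refine eq_bot_iff.2 fun a ha => ?_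
  have := h2 ⟨star a * a, IsSelfAdjoint.star_mul_self a⟩ (I.mul_mem_left _ ha)
  exact (CStarRing.star_mul_self_eq_zero_iff a).1 this

theorem quotient_commutative_of_centralModulo_eq_top {I : Ideal A} [I.IsTwoSided]
    (hI : IsClosed (I : Set A)) (h : centralModulo I = ⊤) (x y : A ⧸ I) : x * y = y * x := by
  let W : Submodule ℂ A := I.restrictScalars ℂ
  have hW : IsClosed (W : Set A) := hI
  have hconj : ∀ {k : unitary A} {b : A}, (k : A) * b - b * k ∈ I →
      (k : A) * b * star (k : A) - b ∈ W := by
    intro k b hk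
    have e : (k : A) * b * star (k : A) - b = ((k : A) * b - b * k) * star (k : A) := by
      rw [sub_mul, mul_assoc b, Unitary.mul_star_self_of_mem k.2, mul_one]
    rw [e]
    exact I.mul_mem_right _ hk
  have h1 : ∀ v ∈ closedCommutatorUnitary A, ∀ d ∈ commutatorLie A, d * (v : A) - v * d ∈ I :=
    fun v hv d hd => commutator_mem_of_forall_conj_sub_mem hW (fun k hk => hconj
      (mem_centralModulo_iff.1 (h ▸ Subgroup.mem_top (⟨k, hk⟩ : closedCommutatorUnitary A))
        ⟨v, hv⟩)) hd
  have h2 : ∀ c ∈ commutatorLie A, ∀ d ∈ commutatorLie A, c * d - d * c ∈ I :=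
    fun c hc d hd => commutator_mem_of_forall_conj_sub_mem hW (fun k hk => hconj (by
      rw [← neg_sub]; exact I.neg_mem (h1 k hk d hd))) hc
  exact quotient_commutative_of_commute_commutators hI (fun a b c d =>
    h2 _ (commutator_mem_commutatorLie a b) _ (commutator_mem_commutatorLie c d)) x y

theorem allProperQuotientsAbelian_of_isTopologicallySimple
    (hZ : ∀ a : A, (∀ b, a * b = b * a) → ∃ z : ℂ, a = algebraMap ℂ A z)
    (h : IsTopologicallySimple
      (closedCommutatorUnitary A ⧸ Subgroup.center (closedCommutatorUnitary A))) :
    AllProperQuotientsAbelian A := by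
  intro I _ hI hbot
  by_cases htop : I = ⊤
  · subst htop
    have : Subsingleton (A ⧸ (⊤ : Ideal A)) := Ideal.Quotient.subsingleton_iff.2 rfl
    exact fun x y => Subsingleton.elim _ _
  set π := QuotientGroup.mk' (Subgroup.center (closedCommutatorUnitary A)) with hπ
  have hcomap : ((centralModulo I).map π).comap π = centralModulo I := by
    rw [Subgroup.comap_map_eq, hπ, QuotientGroup.ker_mk', sup_eq_left]
    exact center_le_centralModulo I
  have hcl : IsClosed (((centralModulo I).map π : Subgroup _) : Set
      (closedCommutatorUnitary A ⧸ Subgroup.center (closedCommutatorUnitary A))) := by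
    rw [← (QuotientGroup.isQuotientMap_mk _).isClosed_preimage]
    have e := congrArg (fun S : Subgroup _ => (S : Set (closedCommutatorUnitary A))) hcomap
    rw [Subgroup.coe_comap] at e
    exact e ▸ isClosed_centralModulo hI
  rcases h _ ((centralModulo_normal I).map π (QuotientGroup.mk'_surjective _)) hcl with h | h
  · refine absurd (eq_bot_of_centralModulo_le_center hZ hI htop ?_) hbot
    rw [← hcomap, h, MonoidHom.comap_bot, hπ, QuotientGroup.ker_mk']
  · refine quotient_commutative_of_centralModulo_eq_top hI ?_
    rw [← hcomap, h, Subgroup.comap_top]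

end Converse

/-! ### Centers of `U_A` and `CU_A` -/

section Center

open Filter Topology NormedSpace selfAdjoint
open scoped ComplexStarModule

variable {A : Type*} [CStarAlgebra A]

theorem mem_scalarUnitaries_of_central
    (hZ : ∀ a : A, (∀ b, a * b = b * a) → ∃ z : ℂ, a = algebraMap ℂ A z)
    {u : unitary A} (hu : ∀ a : A, (u : A) * a = a * u) : u ∈ scalarUnitaries A := by
  rcases subsingleton_or_nontrivial A with hA | hA
  · exact ⟨1, Subsingleton.elim _ _⟩
  · obtain ⟨z, hz⟩ := hZ u hu
    have h1 : ‖z‖ = 1 := by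
      rw [← norm_algebraMap' A z, ← hz]
      exact CStarRing.norm_coe_unitary u
    exact ⟨⟨z, mem_sphere_zero_iff_norm.2 h1⟩, hz⟩

theorem scalarUnitaries_le_unitaryComponent : scalarUnitaries A ≤ unitaryComponent A := by
  rintro u ⟨z, hz⟩
  have e : u = expUnitary ((Complex.arg z) • (1 : selfAdjoint A)) := by
    have h1 : (z : ℂ) = exp ((Complex.arg z : ℂ) * Complex.I) := by
      rw [← Complex.exp_eq_exp_ℂ, ← Circle.coe_exp, Circle.exp_arg]
    have h2 : algebraMap ℂ A ((Complex.arg z : ℂ) * Complex.I)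
        = Complex.I • (((Complex.arg z) • (1 : selfAdjoint A) : selfAdjoint A) : A) := by
      rw [Algebra.algebraMap_eq_smul_one, selfAdjoint.val_smul, selfAdjoint.val_one,
        ← Complex.coe_smul, smul_smul, mul_comm]
    ext
    rw [hz, expUnitary_coe, ← h2, ← algebraMap_exp_comm, ← h1]
  rw [e]
  exact expUnitary_mem_unitaryComponent _

theorem centerOf_unitaryComponent
    (hZ : ∀ a : A, (∀ b, a * b = b * a) → ∃ z : ℂ, a = algebraMap ℂ A z) :
    centerOf (unitaryComponent A) = scalarUnitaries A := by
  apply le_antisymm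
  · rintro _ ⟨u, hu, rfl⟩
    exact mem_scalarUnitaries_of_central hZ (central_of_commute_unitaryComponent fun v hv =>
      (congrArg Subtype.val (Subgroup.mem_center_iff.1 hu ⟨v, hv⟩)).symm)
  · intro u hu
    refine ⟨⟨u, scalarUnitaries_le_unitaryComponent hu⟩, Subgroup.mem_center_iff.2 fun v => ?_, rfl⟩
    obtain ⟨z, hz⟩ := hu
    refine Subtype.ext (Subtype.ext ?_)
    change ((v : unitary A) : A) * (u : A) = u * ((v : unitary A) : A)
    rw [hz]
    exact (Algebra.commutes _ _).symm

theorem centerOf_closedCommutatorUnitary_le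
    (hZ : ∀ a : A, (∀ b, a * b = b * a) → ∃ z : ℂ, a = algebraMap ℂ A z) :
    centerOf (closedCommutatorUnitary A) ≤ centerOf (unitaryComponent A) := by
  rw [centerOf_unitaryComponent hZ]
  rintro _ ⟨u, hu, rfl⟩
  exact mem_scalarUnitaries_of_central hZ (central_of_commute_closedCommutatorUnitary fun v hv =>
    (congrArg Subtype.val (Subgroup.mem_center_iff.1 hu ⟨v, hv⟩)).symm)

end Center

/-! ### The center of the reduced C⋆-algebra of an ICC group -/

section GroupAlgebra

variable {G : Type*} [Group G]

/-- Right translation by `s` on `ℓ²(G)`: `(f · s) t = f (t * s)`. -/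
noncomputable def rightTranslate (s : G) :
    lp (fun _ : G => ℂ) 2 →ₗᵢ[ℂ] lp (fun _ : G => ℂ) 2 where
  toFun f := ⟨fun t => f (t * s), by
    have hp : 0 < (2 : ℝ≥0∞).toReal := by simp
    exact memℓp_gen (((Equiv.mulRight s).summable_iff
      (f := fun t => ‖f t‖ ^ (2 : ℝ≥0∞).toReal)).2 ((lp.memℓp f).summable hp))⟩
  map_add' f g := by ext t; rfl
  map_smul' c f := by ext t; rfl
  norm_map' f := by
    have hp : 0 < (2 : ℝ≥0∞).toReal := by simp
    rw [lp.norm_eq_tsum_rpow hp, lp.norm_eq_tsum_rpow hp]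
    congr 1
    exact (Equiv.mulRight s).tsum_eq (fun t => ‖f t‖ ^ (2 : ℝ≥0∞).toReal)

/-- Right translation as a bounded operator on `ℓ²(G)`. -/
noncomputable def rightRegular (s : G) :
    lp (fun _ : G => ℂ) 2 →L[ℂ] lp (fun _ : G => ℂ) 2 :=
  (rightTranslate s).toContinuousLinearMap

theorem rightRegular_apply (s : G) (f : lp (fun _ : G => ℂ) 2) (t : G) :
    rightRegular s f t = f (t * s) := rfl

theorem leftRegular_apply_apply (s : G) (f : lp (fun _ : G => ℂ) 2) (t : G) :
    leftRegular G s f t = f (s⁻¹ * t) := rfl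

theorem star_rightRegular (s : G) : star (rightRegular s) = rightRegular s⁻¹ := by
  have h1 : star (rightRegular s) * rightRegular s = 1 := by
    rw [ContinuousLinearMap.star_eq_adjoint]
    exact (ContinuousLinearMap.norm_map_iff_adjoint_comp_self _).1 (rightTranslate s).norm_map
  have h2 : rightRegular s * rightRegular s⁻¹ = 1 := by
    ext f t
    change f (t * s * s⁻¹) = f t
    rw [mul_inv_cancel_right]
  exact left_inv_eq_right_inv h1 h2

/-- The reduced group C⋆-algebra commutes with right translations. -/
theorem reducedGroupCStarAlgebra_comm_rightRegular
    {a : lp (fun _ : G => ℂ) 2 →L[ℂ] lp (fun _ : G => ℂ) 2}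
    (ha : a ∈ reducedGroupCStarAlgebra G) (s : G) : rightRegular s * a = a * rightRegular s := by
  have hle : reducedGroupCStarAlgebra G ≤ StarSubalgebra.centralizer ℂ {rightRegular s} := by
    refine StarSubalgebra.topologicalClosure_minimal (StarAlgebra.adjoin_le ?_) ?_
    · rintro _ ⟨g, rfl⟩
      have hcomm : ∀ r : G,
          rightRegular r * leftRegular G g = leftRegular G g * rightRegular r := by
        intro r
        ext f t
        change f (g⁻¹ * (t * r)) = f (g⁻¹ * t * r)
        rw [mul_assoc]
      rw [SetLike.mem_coe, StarSubalgebra.mem_centralizer_iff]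
      rintro _ rfl
      exact ⟨hcomm s, by rw [star_rightRegular]; exact hcomm _⟩
    · rw [StarSubalgebra.coe_centralizer]
      exact Set.isClosed_centralizer _
  exact ((StarSubalgebra.mem_centralizer_iff ℂ).1 (hle ha) _ rfl).1

theorem leftRegular_mem_reducedGroupCStarAlgebra (s : G) :
    leftRegular G s ∈ reducedGroupCStarAlgebra G :=
  StarSubalgebra.le_topologicalClosure _ (StarAlgebra.subset_adjoin ℂ _ ⟨s, rfl⟩)

theorem eq_zero_of_infinite_conjugatesOf {f : lp (fun _ : G => ℂ) 2}
    (hf : ∀ s t : G, f (s * t * s⁻¹) = f t) {g : G} (hg : (conjugatesOf g).Infinite) : f g = 0 := by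
  by_contra hne
  have hs := ((lp.memℓp f).summable (by simp)).tendsto_cofinite_zero
  have hpos : 0 < ‖f g‖ ^ (2 : ℝ≥0∞).toReal := by
    have := norm_pos_iff.2 hne
    positivity
  have hev := hs.eventually (gt_mem_nhds hpos)
  refine hg (Set.Finite.subset (Filter.eventually_cofinite.1 hev) ?_)
  intro x hx
  obtain ⟨c, rfl⟩ := isConj_iff.1 hx
  simp [hf]

/-- The reduced C⋆-algebra of an ICC group has trivial center: for central `a`, the vector `a δ₁` is
constant on conjugacy classes, hence a multiple of `δ₁`. -/
theorem exists_eq_algebraMap_of_central (hG : IsICC G) (a : reducedGroupCStarAlgebra G)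
    (ha : ∀ b, a * b = b * a) : ∃ z : ℂ, a = algebraMap ℂ (reducedGroupCStarAlgebra G) z := by
  classical
  let δ : G → lp (fun _ : G => ℂ) 2 := fun s => lp.single 2 s (1 : ℂ)
  let T : lp (fun _ : G => ℂ) 2 →L[ℂ] lp (fun _ : G => ℂ) 2 := a
  have hδ : ∀ s t : G, δ s t = if t = s then 1 else 0 := by
    intro s t
    simp only [δ, lp.single_apply, Pi.single_apply]
  have hl : ∀ s, leftRegular G s (δ 1) = δ s := by
    intro s
    ext t
    rw [leftRegular_apply_apply, hδ, hδ]
    simp only [inv_mul_eq_one, eq_comm]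
  have hr : ∀ s, rightRegular s⁻¹ (δ 1) = δ s := by
    intro s
    ext t
    rw [rightRegular_apply, hδ, hδ]
    simp only [mul_inv_eq_one]
  have hTl : ∀ s v, T (leftRegular G s v) = leftRegular G s (T v) := by
    intro s v
    have := congrArg Subtype.val (ha ⟨_, leftRegular_mem_reducedGroupCStarAlgebra s⟩)
    exact DFunLike.congr_fun this v
  have hTr : ∀ s v, T (rightRegular s v) = rightRegular s (T v) := by
    intro s v
    exact (DFunLike.congr_fun (reducedGroupCStarAlgebra_comm_rightRegular a.2 s) v).symm
  have hconj : ∀ s t : G, T (δ 1) (s * t * s⁻¹) = T (δ 1) t := by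
    intro s t
    have h : leftRegular G s (T (δ 1)) = rightRegular s⁻¹ (T (δ 1)) := by
      rw [← hTl, ← hTr, hl, hr]
    have h' := congrArg (fun f : lp (fun _ : G => ℂ) 2 => f (s * t)) h
    simp only [leftRegular_apply_apply, rightRegular_apply, inv_mul_cancel_left] at h'
    exact h'.symm
  have h1 : T (δ 1) = (T (δ 1) 1) • δ 1 := by
    ext t
    rw [lp.coeFn_smul, Pi.smul_apply, hδ]
    by_cases ht : t = 1
    · subst ht; simp
    · rw [if_neg ht, smul_zero]
      exact eq_zero_of_infinite_conjugatesOf hconj (hG.2 t ht)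
  have h2 : ∀ s, T (δ s) = (T (δ 1) 1) • δ s := by
    intro s
    rw [← hl, hTl, h1, map_smul, ← h1]
  refine ⟨T (δ 1) 1, Subtype.ext ?_⟩
  change T = algebraMap ℂ _ _
  ext1 f
  rw [Algebra.algebraMap_eq_smul_one]
  change T f = (T (δ 1) 1) • f
  have hsum := lp.hasSum_single (p := 2) (by simp) f
  refine (hsum.mapL T).unique ?_
  have := hsum.const_smul (T (δ 1) 1)
  convert this using 2 with s
  have e : lp.single 2 s (f s) = f s • δ s := by
    simp only [δ]
    rw [← lp.single_smul]; simp
  rw [e, map_smul, h2, smul_comm]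

end GroupAlgebra

theorem mainTheorem10 (G : Type*) [Group G] [Countable G] (hG : IsICC G) :
    (AllProperQuotientsAbelian (reducedGroupCStarAlgebra G) ↔
      IsTopologicallySimple
        (closedCommutatorUnitary (reducedGroupCStarAlgebra G) ⧸
          Subgroup.center (closedCommutatorUnitary (reducedGroupCStarAlgebra G)))) ∧
    (IsTopologicallySimple
        (closedCommutatorUnitary (reducedGroupCStarAlgebra G) ⧸
          Subgroup.center (closedCommutatorUnitary (reducedGroupCStarAlgebra G))) →
      centerOf (closedCommutatorUnitary (reducedGroupCStarAlgebra G)) ≤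
          centerOf (unitaryComponent (reducedGroupCStarAlgebra G)) ∧
        centerOf (unitaryComponent (reducedGroupCStarAlgebra G)) =
          scalarUnitaries (reducedGroupCStarAlgebra G)) :=
  have hZ := exists_eq_algebraMap_of_central hG
  ⟨⟨isTopologicallySimple_of_allProperQuotientsAbelian,
    allProperQuotientsAbelian_of_isTopologicallySimple hZ⟩,
    fun _ => ⟨centerOf_closedCommutatorUnitary_le hZ, centerOf_unitaryComponent hZ⟩⟩
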